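/- Let $\mathcal K$ be a complex Hilbert space with scalar product $(\cdot,\cdot)$ antilinear in the first argument, and let ${}^*\mathrm{CAR}$ be the unital complex *-algebra with unit $E$ generated by elements $a(f)$, $f\in\mathcal K$, depending antilinearly on $f$, subject to the relations $a(f)a(g)+a(g)a(f)=0$ and $a(f)a(g)^*+a(g)^*a(f)=(f,g)E$. Let $X$ be an abelian group, written additively, with a biadditive antisymmetric form $\{\cdot,\cdot\}:X\times X\to\mathbb R$ (nondegeneracy is not required), and let $x\mapsto\beta_x$ be a homomorphism from $X$ to the group of *-automorphisms of ${}^*\mathrm{CAR}$. Let $\mathcal B$ be the unital complex *-algebra generated by elements $a(f)$ ($f\in\mathcal K$) and $W(x)$ ($x\in X$), with unit $E$, subject to the above relations for the $a(f)$ together with $$W(x)^*=W(-x),\qquad W(0)=E,\qquad W(x)W(y)=e^{-\frac i2\{x,y\}}\,W(x+y),$$ $$W(x)\,C=\beta_x(C)\,W(x)\qquad\text{for all } x,y\in X \text{ and } C\in{}^*\mathrm{CAR};$$ here, and below, an element $C$ of ${}^*\mathrm{CAR}$ also denotes its image under the canonical *-homomorphism ${}^*\mathrm{CAR}\to\mathcal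 B$, $a(f)\mapsto a(f)$. Then the following hold. (i) If $n\ge 1$, $x_1,\dots,x_n\in X$ are pairwise distinct and $C_1,\dots,C_n$ are nonzero elements of ${}^*\mathrm{CAR}$, then $\sum_{i=1}^n C_iW(x_i)\neq 0$ in $\mathcal B$. Every element of $\mathcal B$ can be written as $\sum_{i=1}^n C_iW(x_i)$ with pairwise distinct $x_i\in X$ and nonzero $C_i\in{}^*\mathrm{CAR}$, in exactly one way up to the order of the terms (the zero element being the empty sum, $n=0$). (ii) There exist a complex Hilbert space $\mathcal H$ and an injective unital *-homomorphism from $\mathcal B$ to the algebra of bounded operators on $\mathcal H$. -/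

import Mathlib

universe u v

noncomputable section

/-- The free unital complex *-algebra on a set `S` of generators: noncommutative polynomials in the
symbols `s` (`Sum.inl s`) and `s*` (`Sum.inr s`). -/
def FreeStarAlg (S : Type*) : Type _ := FreeAlgebra ℂ (S ⊕ S)

namespace FreeStarAlg

instance instRing (S : Type*) : Ring (FreeStarAlg S) :=
  inferInstanceAs (Ring (FreeAlgebra ℂ (S ⊕ S)))

instance instAlgebra (S : Type*) : Algebra ℂ (FreeStarAlg S) :=
  inferInstanceAs (Algebra ℂ (FreeAlgebra ℂ (S ⊕ S)))

/-- The generator `s`. -/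
def gen {S : Type*} (s : S) : FreeStarAlg S := FreeAlgebra.ι ℂ (Sum.inl s)

/-- The adjoint generator `s*`. -/
def genStar {S : Type*} (s : S) : FreeStarAlg S := FreeAlgebra.ι ℂ (Sum.inr s)

theorem induction {S : Type*} {motive : FreeStarAlg S → Prop}
    (scalar : ∀ c : ℂ, motive (algebraMap ℂ (FreeStarAlg S) c))
    (gen : ∀ s, motive (gen s)) (genStar : ∀ s, motive (genStar s))
    (mul : ∀ a b, motive a → motive b → motive (a * b))
    (add : ∀ a b, motive a → motive b → motive (a + b)) (a : FreeStarAlg S) : motive a :=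
  FreeAlgebra.induction ℂ (S ⊕ S) (motive := motive) scalar
    (fun x => Sum.casesOn x gen genStar) mul add a

/-- The antilinear antihomomorphism `s ↦ s*`, `s* ↦ s`, as a map into the opposite ring. It is
obtained from the universal property of the free algebra, the target carrying the complex
conjugate scalar action. -/
def starAux (S : Type*) : FreeStarAlg S →+* (FreeStarAlg S)ᵐᵒᵖ :=
  letI : Algebra ℂ (FreeStarAlg S)ᵐᵒᵖ :=
    ((algebraMap ℂ (FreeStarAlg S)ᵐᵒᵖ).comp (starRingEnd ℂ)).toAlgebra'
      (fun c x => Algebra.commutes (starRingEnd ℂ c) x)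
  (FreeAlgebra.lift ℂ (fun x : S ⊕ S =>
    (MulOpposite.op (FreeAlgebra.ι ℂ x.swap) : (FreeStarAlg S)ᵐᵒᵖ))).toRingHom

theorem starAux_algebraMap {S : Type*} (c : ℂ) :
    starAux S (algebraMap ℂ (FreeStarAlg S) c) =
      MulOpposite.op (algebraMap ℂ (FreeStarAlg S) (starRingEnd ℂ c)) := by
  let _ : Algebra ℂ (FreeStarAlg S)ᵐᵒᵖ :=
    ((algebraMap ℂ (FreeStarAlg S)ᵐᵒᵖ).comp (starRingEnd ℂ)).toAlgebra'
      (fun c x => Algebra.commutes (starRingEnd ℂ c) x)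
  exact (FreeAlgebra.lift ℂ (fun x : S ⊕ S =>
    (MulOpposite.op (FreeAlgebra.ι ℂ x.swap) : (FreeStarAlg S)ᵐᵒᵖ))).commutes c

theorem starAux_gen {S : Type*} (s : S) : starAux S (gen s) = MulOpposite.op (genStar s) := by
  let _ : Algebra ℂ (FreeStarAlg S)ᵐᵒᵖ :=
    ((algebraMap ℂ (FreeStarAlg S)ᵐᵒᵖ).comp (starRingEnd ℂ)).toAlgebra'
      (fun c x => Algebra.commutes (starRingEnd ℂ c) x)
  exact FreeAlgebra.lift_ι_apply _ _

theorem starAux_genStar {S : Type*} (s : S) : starAux S (genStar s) = MulOpposite.op (gen s) := by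
  let _ : Algebra ℂ (FreeStarAlg S)ᵐᵒᵖ :=
    ((algebraMap ℂ (FreeStarAlg S)ᵐᵒᵖ).comp (starRingEnd ℂ)).toAlgebra'
      (fun c x => Algebra.commutes (starRingEnd ℂ c) x)
  exact FreeAlgebra.lift_ι_apply _ _

instance instStarRing (S : Type*) : StarRing (FreeStarAlg S) where
  star x := (starAux S x).unop
  star_involutive x := by
    induction x using FreeStarAlg.induction with
    | scalar c => simp [starAux_algebraMap]
    | gen s => simp [starAux_gen, starAux_genStar]
    | genStar s => simp [starAux_gen, starAux_genStar]
    | mul a b ha hb => simp [ha, hb]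
    | add a b ha hb => simp [ha, hb]
  star_mul a b := by simp
  star_add a b := by simp

theorem star_def {S : Type*} (x : FreeStarAlg S) : star x = (starAux S x).unop := rfl

theorem star_gen {S : Type*} (s : S) : star (gen s) = genStar s := by
  simp [star_def, starAux_gen]

theorem star_genStar {S : Type*} (s : S) : star (genStar s) = gen s := by
  simp [star_def, starAux_genStar]

theorem star_algebraMap {S : Type*} (c : ℂ) :
    star (algebraMap ℂ (FreeStarAlg S) c) = algebraMap ℂ (FreeStarAlg S) (star c) := by
  simp [star_def, starAux_algebraMap]

instance instStarModule (S : Type*) : StarModule ℂ (FreeStarAlg S) where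
  star_smul c x := by
    rw [Algebra.smul_def, star_mul, star_algebraMap, ← Algebra.commutes, ← Algebra.smul_def]

/-- The universal property of the free *-algebra. -/
def lift {S A : Type*} [Ring A] [Algebra ℂ A] [StarRing A] [StarModule ℂ A] (φ : S → A) :
    FreeStarAlg S →⋆ₐ[ℂ] A where
  toAlgHom := FreeAlgebra.lift ℂ (Sum.elim φ (fun s => star (φ s)))
  map_star' x := by
    set F : FreeStarAlg S →ₐ[ℂ] A := FreeAlgebra.lift ℂ (Sum.elim φ (fun s => star (φ s))) with hF
    have h1 : ∀ s, F (gen s) = φ s := fun s => FreeAlgebra.lift_ι_apply _ _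
    have h2 : ∀ s, F (genStar s) = star (φ s) := fun s => FreeAlgebra.lift_ι_apply _ _
    change F (star x) = star (F x)
    induction x using FreeStarAlg.induction with
    | scalar c => rw [star_algebraMap, F.commutes, F.commutes, algebraMap_star_comm]
    | gen s => rw [star_gen, h1, h2]
    | genStar s => rw [star_genStar, h1, h2, star_star]
    | mul a b ha hb => rw [star_mul, map_mul, map_mul, star_mul, ha, hb]
    | add a b ha hb => rw [star_add, map_add, map_add, star_add, ha, hb]

theorem lift_gen {S A : Type*} [Ring A] [Algebra ℂ A] [StarRing A] [StarModule ℂ A] (φ : S → A)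
    (s : S) : lift φ (gen s) = φ s :=
  FreeAlgebra.lift_ι_apply _ _

theorem hom_ext {S A : Type*} [Ring A] [Algebra ℂ A] [StarRing A] [StarModule ℂ A]
    {F G : FreeStarAlg S →⋆ₐ[ℂ] A} (h : ∀ s, F (gen s) = G (gen s)) : F = G := by
  ext x
  induction x using FreeStarAlg.induction with
  | scalar c => rw [AlgHomClass.commutes, AlgHomClass.commutes]
  | gen s => exact h s
  | genStar s => rw [← star_gen, map_star, map_star, h]
  | mul a b ha hb => rw [map_mul, map_mul, ha, hb]
  | add a b ha hb => rw [map_add, map_add, ha, hb]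

end FreeStarAlg

/-- A set of relations `r`, together with the adjoint relations. -/
inductive StarClosure {S : Type*} (r : FreeStarAlg S → FreeStarAlg S → Prop) :
    FreeStarAlg S → FreeStarAlg S → Prop
  | of {p q : FreeStarAlg S} : r p q → StarClosure r p q
  | adj {p q : FreeStarAlg S} : r p q → StarClosure r (star p) (star q)

theorem StarClosure.star_mem {S : Type*} {r : FreeStarAlg S → FreeStarAlg S → Prop}
    (p q : FreeStarAlg S) (h : StarClosure r p q) : StarClosure r (star p) (star q) := by
  cases h with
  | of h => exact .adj h
  | adj h => simpa only [star_star] using StarClosure.of h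

/-- The unital complex *-algebra with generators `S` and relations `r p q` (meaning `p = q`):
the quotient of the free *-algebra by the two-sided *-ideal generated by all `p - q`. -/
def PresentedStarAlg {S : Type*} (r : FreeStarAlg S → FreeStarAlg S → Prop) : Type _ :=
  RingQuot (StarClosure r)

namespace PresentedStarAlg

instance instRing {S : Type*} (r : FreeStarAlg S → FreeStarAlg S → Prop) :
    Ring (PresentedStarAlg r) :=
  inferInstanceAs (Ring (RingQuot (StarClosure r)))

instance instAlgebra {S : Type*} (r : FreeStarAlg S → FreeStarAlg S → Prop) :
    Algebra ℂ (PresentedStarAlg r) :=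
  inferInstanceAs (Algebra ℂ (RingQuot (StarClosure r)))

instance instStarRing {S : Type*} (r : FreeStarAlg S → FreeStarAlg S → Prop) :
    StarRing (PresentedStarAlg r) :=
  RingQuot.starRing (StarClosure r) StarClosure.star_mem

/-- The quotient map as an algebra homomorphism. -/
def mkAlg {S : Type*} (r : FreeStarAlg S → FreeStarAlg S → Prop) :
    FreeStarAlg S →ₐ[ℂ] PresentedStarAlg r :=
  RingQuot.mkAlgHom ℂ (StarClosure r)

theorem mkAlg_surjective {S : Type*} (r : FreeStarAlg S → FreeStarAlg S → Prop) :
    Function.Surjective (mkAlg r) :=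
  RingQuot.mkAlgHom_surjective ℂ (StarClosure r)

theorem mkAlg_star {S : Type*} (r : FreeStarAlg S → FreeStarAlg S → Prop) (x : FreeStarAlg S) :
    mkAlg r (star x) = star (mkAlg r x) := by
  simp only [mkAlg, RingQuot.mkAlgHom_def, RingQuot.mkRingHom_def]
  rfl

instance instStarModule {S : Type*} (r : FreeStarAlg S → FreeStarAlg S → Prop) :
    StarModule ℂ (PresentedStarAlg r) where
  star_smul c x := by
    obtain ⟨x, rfl⟩ := mkAlg_surjective r x
    rw [← map_smul, ← mkAlg_star, star_smul, map_smul, mkAlg_star]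

/-- The quotient map: the class of a *-polynomial in the generators. -/
def mk {S : Type*} (r : FreeStarAlg S → FreeStarAlg S → Prop) :
    FreeStarAlg S →⋆ₐ[ℂ] PresentedStarAlg r where
  toAlgHom := mkAlg r
  map_star' := mkAlg_star r

theorem mk_surjective {S : Type*} (r : FreeStarAlg S → FreeStarAlg S → Prop) :
    Function.Surjective (mk r) :=
  mkAlg_surjective r

theorem mk_rel {S : Type*} {r : FreeStarAlg S → FreeStarAlg S → Prop} {p q : FreeStarAlg S}
    (h : r p q) : mk r p = mk r q :=
  RingQuot.mkAlgHom_rel ℂ (StarClosure.of h)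

/-- The universal property of the *-algebra presented by generators and relations. -/
def lift {S A : Type*} [Ring A] [Algebra ℂ A] [StarRing A] [StarModule ℂ A]
    {r : FreeStarAlg S → FreeStarAlg S → Prop} (F : FreeStarAlg S →⋆ₐ[ℂ] A)
    (hF : ∀ p q, r p q → F p = F q) : PresentedStarAlg r →⋆ₐ[ℂ] A where
  toAlgHom := RingQuot.liftAlgHom ℂ ⟨F.toAlgHom, by
    intro p q h
    cases h with
    | of h => exact hF _ _ h
    | @adj p q h =>
      change F (star p) = F (star q)
      rw [map_star, map_star, hF _ _ h]⟩
  map_star' x := by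
    obtain ⟨x, rfl⟩ := mkAlg_surjective r x
    rw [← mkAlg_star]
    simp only [mkAlg]
    change RingQuot.liftAlgHom ℂ _ (RingQuot.mkAlgHom ℂ (StarClosure r) (star x)) =
      star (RingQuot.liftAlgHom ℂ _ (RingQuot.mkAlgHom ℂ (StarClosure r) x))
    rw [RingQuot.liftAlgHom_mkAlgHom_apply, RingQuot.liftAlgHom_mkAlgHom_apply]
    exact map_star F x

theorem lift_mk {S A : Type*} [Ring A] [Algebra ℂ A] [StarRing A] [StarModule ℂ A]
    {r : FreeStarAlg S → FreeStarAlg S → Prop} (F : FreeStarAlg S →⋆ₐ[ℂ] A)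
    (hF : ∀ p q, r p q → F p = F q) (x : FreeStarAlg S) : lift F hF (mk r x) = F x :=
  RingQuot.liftAlgHom_mkAlgHom_apply ℂ _ _ x

end PresentedStarAlg

open FreeStarAlg in
/-- The CAR relations for the generators `a(f)`, `f ∈ K`: antilinearity in `f`,
`[a(f), a(g)]₊ = 0` and `[a(f), a(g)*]₊ = (f, g) E`. The scalar product is antilinear in its first
and linear in its second argument. -/
inductive CARRel (K : Type*) [NormedAddCommGroup K] [InnerProductSpace ℂ K] :
    FreeStarAlg K → FreeStarAlg K → Prop
  | add (f g : K) : CARRel K (gen (f + g)) (gen f + gen g)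
  | smul (c : ℂ) (f : K) : CARRel K (gen (c • f)) (starRingEnd ℂ c • gen f)
  | anticomm (f g : K) : CARRel K (gen f * gen g + gen g * gen f) 0
  | anticomm_star (f g : K) :
      CARRel K (gen f * star (gen g) + star (gen g) * gen f) (inner ℂ f g • 1)

/-- The (purely algebraic) *-algebra `*CAR` over `K`. -/
abbrev StarCAR (K : Type*) [NormedAddCommGroup K] [InnerProductSpace ℂ K] : Type _ :=
  PresentedStarAlg (CARRel K)

/-- *-polynomials in the symbols `a(f)`, seen among those in the symbols `a(f)` and `W(x)`. -/
def carPoly (K X : Type*) : FreeStarAlg K →⋆ₐ[ℂ] FreeStarAlg (K ⊕ X) :=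
  FreeStarAlg.lift (fun f => FreeStarAlg.gen (Sum.inl f))

/-- The symbol `W(x)`. -/
def weylSymb (K : Type*) {X : Type*} (x : X) : FreeStarAlg (K ⊕ X) :=
  FreeStarAlg.gen (Sum.inr x)

/-- The relations between the generators `a(f)`, `f ∈ K`, and `W(x)`, `x ∈ X`: the CAR relations,
the Weyl relations for the form `σ`, and `W(x) C = β_x(C) W(x)` for all `C` in `*CAR`. In the last
one `p` is a *-polynomial in the `a(f)` representing `C`, and `q` one representing `β_x(C)`. -/
inductive FieldRel {K X : Type*} [NormedAddCommGroup K] [InnerProductSpace ℂ K] [AddCommGroup X]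
    (σ : X →+ X →+ ℝ) (β : Multiplicative X →* (StarCAR K ≃⋆ₐ[ℂ] StarCAR K)) :
    FreeStarAlg (K ⊕ X) → FreeStarAlg (K ⊕ X) → Prop
  | car {p q : FreeStarAlg K} (h : CARRel K p q) : FieldRel σ β (carPoly K X p) (carPoly K X q)
  | weyl_star (x : X) : FieldRel σ β (star (weylSymb K x)) (weylSymb K (-x))
  | weyl_zero : FieldRel σ β (weylSymb K 0) 1
  | weyl_mul (x y : X) : FieldRel σ β (weylSymb K x * weylSymb K y)
      (Complex.exp (-(Complex.I / 2) * (σ x y : ℂ)) • weylSymb K (x + y))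
  | twist (x : X) (p q : FreeStarAlg K)
      (h : PresentedStarAlg.mk (CARRel K) q =
        β (Multiplicative.ofAdd x) (PresentedStarAlg.mk (CARRel K) p)) :
      FieldRel σ β (weylSymb K x * carPoly K X p) (carPoly K X q * weylSymb K x)

/-- The *-algebra `𝓑` generated by the `a(f)` and `W(x)`. -/
abbrev FieldStarAlg {K X : Type*} [NormedAddCommGroup K] [InnerProductSpace ℂ K] [AddCommGroup X]
    (σ : X →+ X →+ ℝ) (β : Multiplicative X →* (StarCAR K ≃⋆ₐ[ℂ] StarCAR K)) : Type _ :=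
  PresentedStarAlg (FieldRel σ β)

namespace FieldStarAlg

/-- The element `W(x)` of `𝓑`. -/
def weyl {K X : Type*} [NormedAddCommGroup K] [InnerProductSpace ℂ K] [AddCommGroup X]
    (σ : X →+ X →+ ℝ) (β : Multiplicative X →* (StarCAR K ≃⋆ₐ[ℂ] StarCAR K)) (x : X) :
    FieldStarAlg σ β :=
  PresentedStarAlg.mk (FieldRel σ β) (weylSymb K x)

/-- The canonical *-homomorphism `*CAR → 𝓑`, sending `a(f)` to `a(f)`. -/
def ofCAR {K X : Type*} [NormedAddCommGroup K] [InnerProductSpace ℂ K] [AddCommGroup X]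
    (σ : X →+ X →+ ℝ) (β : Multiplicative X →* (StarCAR K ≃⋆ₐ[ℂ] StarCAR K)) :
    StarCAR K →⋆ₐ[ℂ] FieldStarAlg σ β :=
  PresentedStarAlg.lift ((PresentedStarAlg.mk (FieldRel σ β)).comp (carPoly K X))
    (fun _ _ h => PresentedStarAlg.mk_rel (FieldRel.car h))

theorem ofCAR_mk {K X : Type*} [NormedAddCommGroup K] [InnerProductSpace ℂ K] [AddCommGroup X]
    (σ : X →+ X →+ ℝ) (β : Multiplicative X →* (StarCAR K ≃⋆ₐ[ℂ] StarCAR K))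
    (p : FreeStarAlg K) :
    ofCAR σ β (PresentedStarAlg.mk (CARRel K) p) =
      PresentedStarAlg.mk (FieldRel σ β) (carPoly K X p) :=
  PresentedStarAlg.lift_mk _ _ _

/-- The twisting relation `W(x) C = β_x(C) W(x)` in `𝓑`. -/
theorem weyl_mul_ofCAR {K X : Type*} [NormedAddCommGroup K] [InnerProductSpace ℂ K]
    [AddCommGroup X] (σ : X →+ X →+ ℝ)
    (β : Multiplicative X →* (StarCAR K ≃⋆ₐ[ℂ] StarCAR K)) (x : X) (C : StarCAR K) :
    weyl σ β x * ofCAR σ β C = ofCAR σ β (β (Multiplicative.ofAdd x) C) * weyl σ β x := by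
  obtain ⟨p, rfl⟩ := PresentedStarAlg.mk_surjective _ C
  obtain ⟨q, hq⟩ := PresentedStarAlg.mk_surjective _
    (β (Multiplicative.ofAdd x) (PresentedStarAlg.mk (CARRel K) p))
  rw [← hq, ofCAR_mk, ofCAR_mk, weyl, ← map_mul, ← map_mul]
  exact PresentedStarAlg.mk_rel (FieldRel.twist x p q hq)

end FieldStarAlg

end

/-! The relations of `𝓑` move every `W(x)` to the right, so the additive map `normalForm` from
finitely supported families `C : X →₀ StarCAR K` to `𝓑` is onto (`normalForm_surjective`).
Everything else follows from one representation `π` of `𝓑` for which `π (normalForm C) = 0` forces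
`C = 0`: then `normalForm` is injective, which is (i), and `π` is injective, which is (ii).

Given a faithful representation `π₀` of `*CAR` on `H₀`, let `π` act on `ℓ²(X, H₀)`: `C` acts at the
site `y` by `π₀(β_{-y}(C))`, and `W(x)` is translation by `x` times a phase. Applied to a vector `v`
placed at the site `0`, `∑ C_x W(x)` has component `π₀(β_{-y}(C_y)) v` at `y`, so the coefficients
separate (`eq_zero_of_rep_normalForm_eq_zero`).

The faithful `π₀` (`StarCAR.exists_faithful_rep`) uses the elements `a(f) + a(f)*`, which form a
Clifford system over the real Hilbert space underlying `K`. A real Hilbert basis gives a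
Jordan–Wigner representation, faithful on the algebra generated by the basis elements. Each element
of `*CAR` lies in such an algebra for a basis adapted to it, and the direct sum over all bases is
faithful. -/

noncomputable section

/-! ### Hilbert sums of operators and of *-representations. -/

section DirectSum

variable {ι : Type*} {E : ι → Type*} [∀ i, NormedAddCommGroup (E i)]

theorem memℓp_two_iff {f : ∀ i, E i} : Memℓp f 2 ↔ Summable fun i => ‖f i‖ ^ 2 := by
  rw [memℓp_gen_iff (by norm_num)]
  simp

theorem lp_two_norm_sq (f : lp E 2) : ‖f‖ ^ 2 = ∑' i, ‖f i‖ ^ 2 := by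
  have := lp.norm_rpow_eq_tsum (p := 2) (by norm_num) f
  simpa using this

theorem lp_two_summable (f : lp E 2) : Summable fun i => ‖f i‖ ^ 2 :=
  memℓp_two_iff.1 (lp.memℓp f)

variable [∀ i, InnerProductSpace ℂ (E i)]

/-- The diagonal operator on a Hilbert sum defined by a bounded family of operators. -/
def lpDiag (T : ∀ i, E i →L[ℂ] E i) (hT : ∃ M, ∀ i, ‖T i‖ ≤ M) : lp E 2 →L[ℂ] lp E 2 :=
  have key : ∀ M, (∀ i, ‖T i‖ ≤ M) → ∀ (ψ : lp E 2) i, ‖T i (ψ i)‖ ^ 2 ≤ M ^ 2 * ‖ψ i‖ ^ 2 := by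
    intro M hM ψ i
    rw [← mul_pow]
    exact pow_le_pow_left₀ (norm_nonneg _) ((T i).le_of_opNorm_le (hM i) _) 2
  have mem : ∀ ψ : lp E 2, Memℓp (fun i => T i (ψ i)) 2 := fun ψ => by
    obtain ⟨M, hM⟩ := hT
    exact memℓp_two_iff.2 (((lp_two_summable ψ).mul_left (M ^ 2)).of_nonneg_of_le
      (fun _ => by positivity) (key M hM ψ))
  LinearMap.mkContinuousOfExistsBound
    { toFun := fun ψ => (⟨fun i => T i (ψ i), mem ψ⟩ : lp E 2)
      map_add' := fun ψ φ => by ext i; simp; rfl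
      map_smul' := fun c ψ => by ext i; simp }
    (by
      obtain ⟨M, hM⟩ := hT
      -- The absolute value matters when `ι` is empty: `M` may then be negative.
      refine ⟨|M|, fun ψ => abs_le_of_sq_le_sq' ?_ (by positivity) |>.2⟩
      rw [mul_pow, sq_abs, lp_two_norm_sq, lp_two_norm_sq, ← tsum_mul_left]
      exact Summable.tsum_le_tsum (key M hM ψ) (memℓp_two_iff.1 (mem ψ))
        ((lp_two_summable ψ).mul_left _))

theorem lpDiag_apply (T : ∀ i, E i →L[ℂ] E i) (hT : ∃ M, ∀ i, ‖T i‖ ≤ M) (ψ : lp E 2) (i : ι) :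
    lpDiag T hT ψ i = T i (ψ i) :=
  rfl

variable [∀ i, CompleteSpace (E i)]

/-- The direct sum of a pointwise bounded family of *-representations. -/
def directSumRep {A : Type*} [Ring A] [StarRing A] [Algebra ℂ A]
    (ρ : ∀ i, A →⋆ₐ[ℂ] (E i →L[ℂ] E i)) (hρ : ∀ a, ∃ M, ∀ i, ‖ρ i a‖ ≤ M) :
    A →⋆ₐ[ℂ] (lp E 2 →L[ℂ] lp E 2) where
  toFun a := lpDiag (fun i => ρ i a) (hρ a)
  map_one' := by ext ψ i; simp [lpDiag_apply]
  map_mul' a b := by ext ψ i; simp [lpDiag_apply]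
  map_zero' := by ext ψ i; simp [lpDiag_apply]
  map_add' a b := by ext ψ i; simp [lpDiag_apply]
  commutes' c := by ext ψ i; simp [lpDiag_apply, Algebra.algebraMap_eq_smul_one]
  map_star' a := by
    rw [ContinuousLinearMap.star_eq_adjoint, ContinuousLinearMap.eq_adjoint_iff]
    intro ψ φ
    rw [lp.inner_eq_tsum, lp.inner_eq_tsum]
    refine tsum_congr fun i => ?_
    rw [lpDiag_apply, lpDiag_apply, map_star, ContinuousLinearMap.star_eq_adjoint,
      ContinuousLinearMap.adjoint_inner_left]

theorem directSumRep_apply {A : Type*} [Ring A] [StarRing A] [Algebra ℂ A]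
    (ρ : ∀ i, A →⋆ₐ[ℂ] (E i →L[ℂ] E i)) (hρ : ∀ a, ∃ M, ∀ i, ‖ρ i a‖ ≤ M) (a : A)
    (ψ : lp E 2) (i : ι) : directSumRep ρ hρ a ψ i = ρ i a (ψ i) :=
  rfl

theorem eq_zero_of_directSumRep_eq_zero {A : Type*} [Ring A] [StarRing A] [Algebra ℂ A]
    {ρ : ∀ i, A →⋆ₐ[ℂ] (E i →L[ℂ] E i)} {hρ : ∀ a, ∃ M, ∀ i, ‖ρ i a‖ ≤ M} {a : A}
    (h : directSumRep ρ hρ a = 0) (i : ι) : ρ i a = 0 := by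
  classical
  ext v
  have := congrArg (fun T => T (lp.single 2 i v) i) h
  simpa [directSumRep_apply] using this

end DirectSum

/-! ### Permutation operators with phases, the common form of `jwGen` and `weylOp`. -/

section WeightedPerm

variable {J E : Type*} [NormedAddCommGroup E] [InnerProductSpace ℂ E]

/-- The operator `ψ ↦ (j ↦ u j • ψ (e j))` on `ℓ²(J, E)`, for a permutation `e` and phases `u`. -/
def weightedPerm (e : J ≃ J) (u : J → ℂ) (hu : ∀ j, ‖u j‖ = 1) :
    lp (fun _ : J => E) 2 →L[ℂ] lp (fun _ : J => E) 2 :=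
  have nrm : ∀ (ψ : lp (fun _ : J => E) 2) j, ‖u j • ψ (e j)‖ ^ 2 = ‖ψ (e j)‖ ^ 2 :=
    fun ψ j => by rw [norm_smul, hu, one_mul]
  have mem : ∀ ψ : lp (fun _ : J => E) 2, Memℓp (fun j => u j • ψ (e j)) 2 := fun ψ => by
    rw [memℓp_two_iff]
    simp_rw [nrm]
    exact (e.summable_iff (f := fun j => ‖ψ j‖ ^ 2)).2 (lp_two_summable ψ)
  LinearMap.mkContinuous
    { toFun := fun ψ => (⟨fun j => u j • ψ (e j), mem ψ⟩ : lp (fun _ : J => E) 2)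
      map_add' := fun ψ φ => by ext j; simp; rfl
      map_smul' := fun c ψ => by ext j; simp [smul_comm c] }
    1 (fun ψ => by
      rw [one_mul]
      refine abs_le_of_sq_le_sq' (le_of_eq ?_) (norm_nonneg _) |>.2
      rw [lp_two_norm_sq, lp_two_norm_sq, ← e.tsum_eq (fun j => ‖ψ j‖ ^ 2)]
      exact tsum_congr (nrm ψ))

theorem weightedPerm_apply (e : J ≃ J) (u : J → ℂ) (hu : ∀ j, ‖u j‖ = 1)
    (ψ : lp (fun _ : J => E) 2) (j : J) : weightedPerm e u hu ψ j = u j • ψ (e j) :=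
  rfl

theorem star_weightedPerm [CompleteSpace E] (e e' : J ≃ J) (u u' : J → ℂ) (hu : ∀ j, ‖u j‖ = 1)
    (hu' : ∀ j, ‖u' j‖ = 1) (he : e' = e.symm) (h : ∀ j, u' (e j) = star (u j)) :
    star (weightedPerm (E := E) e u hu) = weightedPerm e' u' hu' := by
  subst he
  rw [ContinuousLinearMap.star_eq_adjoint, eq_comm, ContinuousLinearMap.eq_adjoint_iff]
  intro ψ φ
  rw [lp.inner_eq_tsum, lp.inner_eq_tsum, ← e.tsum_eq]
  refine tsum_congr fun j => ?_
  rw [weightedPerm_apply, weightedPerm_apply, h, inner_smul_left, inner_smul_right,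
    e.symm_apply_apply]
  simp

end WeightedPerm

/-! ### Jordan–Wigner operators and ordered Clifford monomials. -/

section JordanWigner

open scoped symmDiff

variable {ι : Type*} [LinearOrder ι]

/-- The Jordan–Wigner sign of `j` relative to `S`. -/
def jwSign (j : ι) (S : Finset ι) : ℤˣ := (-1) ^ (S.filter (· < j)).card

/-- Adding `j` to `S` if it is absent, removing it if it is present. -/
def toggle (j : ι) : Finset ι ≃ Finset ι where
  toFun S := S ∆ {j}
  invFun S := S ∆ {j}
  left_inv _ := symmDiff_symmDiff_cancel_right _ _
  right_inv _ := symmDiff_symmDiff_cancel_right _ _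

theorem toggle_symm (j : ι) : (toggle j).symm = toggle j := rfl

theorem toggle_toggle (j : ι) (S : Finset ι) : toggle j (toggle j S) = S :=
  (toggle j).left_inv S

theorem toggle_comm (j k : ι) (S : Finset ι) :
    toggle j (toggle k S) = toggle k (toggle j S) :=
  symmDiff_right_comm _ _ _

theorem mem_toggle {j k : ι} {S : Finset ι} :
    k ∈ toggle j S ↔ (k ∈ S ∧ k ≠ j ∨ k = j ∧ k ∉ S) := by
  simp [toggle, Finset.mem_symmDiff]

theorem toggle_of_notMem {j : ι} {S : Finset ι} (h : j ∉ S) : toggle j S = insert j S := by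
  ext k
  rw [mem_toggle, Finset.mem_insert]
  grind

theorem toggle_insert_self {j : ι} {S : Finset ι} (h : j ∉ S) : toggle j (insert j S) = S := by
  rw [← toggle_of_notMem h, toggle_toggle]

theorem toggle_insert {j a : ι} {S : Finset ι} (h : j ≠ a) :
    toggle j (insert a S) = insert a (toggle j S) := by
  ext k
  simp only [mem_toggle, Finset.mem_insert]
  grind

theorem jwSign_toggle_of_le {j k : ι} (h : j ≤ k) (S : Finset ι) :
    jwSign j (toggle k S) = jwSign j S := by
  have : (toggle k S).filter (· < j) = S.filter (· < j) := by
    ext i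
    simp only [Finset.mem_filter, mem_toggle]
    grind
  rw [jwSign, this, jwSign]

theorem jwSign_insert_of_lt {j k : ι} (h : k < j) {S : Finset ι} (hS : k ∉ S) :
    jwSign j (insert k S) = -jwSign j S := by
  rw [jwSign, Finset.filter_insert, if_pos h, Finset.card_insert_of_notMem (by simp [hS]),
    pow_succ, jwSign]
  simp

/-- The number of elements below `j` changes by one. Together with `jwSign_toggle_of_le` this
asymmetry is the source of anticommutation: of the two orders in which `j ≠ k` are toggled, exactly
one picks up an extra sign. -/
theorem jwSign_toggle_of_lt {j k : ι} (h : k < j) (S : Finset ι) :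
    jwSign j (toggle k S) = -jwSign j S := by
  by_cases hk : k ∈ S
  · obtain ⟨T, hT, rfl⟩ : ∃ T, k ∉ T ∧ S = insert k T :=
      ⟨S.erase k, by simp, by rw [Finset.insert_erase hk]⟩
    rw [toggle_insert_self hT, jwSign_insert_of_lt h hT, neg_neg]
  · rw [toggle_of_notMem hk, jwSign_insert_of_lt h hk]

theorem jwSign_eq_one {j : ι} {S : Finset ι} (h : ∀ i ∈ S, j ≤ i) : jwSign j S = 1 := by
  rw [jwSign, Finset.filter_false_of_mem (fun i hi => (h i hi).not_gt)]
  rfl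

/-- Ordered products of anticommuting elements. -/
def orderedProd {A : Type*} [Monoid A] (e : ι → A) (S : Finset ι) : A :=
  ((S.sort (· ≤ ·)).map e).prod

theorem orderedProd_empty {A : Type*} [Monoid A] (e : ι → A) : orderedProd e ∅ = 1 := by
  simp [orderedProd]

theorem orderedProd_insert {A : Type*} [Monoid A] (e : ι → A) {a : ι} {S : Finset ι}
    (h : ∀ b ∈ S, a < b) : orderedProd e (insert a S) = e a * orderedProd e S := by
  rw [orderedProd, Finset.sort_insert (· ≤ ·) (fun b hb => (h b hb).le)
    (fun ha => lt_irrefl _ (h a ha)), List.map_cons, List.prod_cons, orderedProd]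

/-- Moving `e j` to its place in the sorted product costs one sign for each smaller factor; there it
is inserted, or cancelled by `e j * e j = 1`. The coefficients are those of `jwGen_single`, so the
Jordan–Wigner operators act as left multiplication on ordered products. -/
theorem mul_orderedProd {A : Type*} [Ring A] (e : ι → A) (hsq : ∀ i, e i * e i = 1)
    (hanti : ∀ i j, i ≠ j → e i * e j = -(e j * e i)) (j : ι) (S : Finset ι) :
    e j * orderedProd e S = jwSign j S • orderedProd e (toggle j S) := by
  induction S using Finset.induction_on_min with
  | empty =>
    rw [jwSign_eq_one (by simp), one_smul, toggle_of_notMem (by simp),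
      orderedProd_insert e (by simp)]
  | insert a S ha ih =>
    have haS : a ∉ S := fun h => lt_irrefl _ (ha a h)
    rcases lt_trichotomy j a with h | rfl | h
    · have hj : ∀ b ∈ insert a S, j < b := by
        intro b hb
        rcases Finset.mem_insert.1 hb with rfl | hb
        exacts [h, h.trans (ha b hb)]
      rw [jwSign_eq_one (fun i hi => (hj i hi).le), one_smul,
        toggle_of_notMem (fun h => lt_irrefl _ (hj j h)), orderedProd_insert e hj]
    · rw [jwSign_eq_one (by simpa using fun i hi => (ha i hi).le), one_smul,
        toggle_insert_self haS, orderedProd_insert e ha, ← mul_assoc, hsq, one_mul]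
    · have hlt : ∀ b ∈ toggle j S, a < b := by
        intro b hb
        rcases mem_toggle.1 hb with hb | hb
        exacts [ha b hb.1, hb.1 ▸ h]
      rw [orderedProd_insert e ha, ← mul_assoc, hanti j a h.ne', neg_mul, mul_assoc, ih,
        toggle_insert h.ne', orderedProd_insert e hlt, jwSign_insert_of_lt h haS, mul_smul_comm,
        Units.neg_smul]

/-- The Jordan–Wigner generators: anticommuting self-adjoint unitaries on `ℓ²(Finset ι)`. -/
def jwGen (j : ι) : lp (fun _ : Finset ι => ℂ) 2 →L[ℂ] lp (fun _ : Finset ι => ℂ) 2 :=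
  weightedPerm (toggle j) (fun S => ((jwSign j S : ℤ) : ℂ))
    (fun S => by rcases Int.units_eq_one_or (jwSign j S) with h | h <;> simp [h])

theorem jwGen_apply (j : ι) (ψ : lp (fun _ : Finset ι => ℂ) 2) (S : Finset ι) :
    jwGen j ψ S = ((jwSign j S : ℤ) : ℂ) * ψ (toggle j S) :=
  rfl

theorem star_jwGen (j : ι) : star (jwGen j) = jwGen j :=
  star_weightedPerm _ _ _ _ _ _ (toggle_symm j).symm
    (fun S => by rw [jwSign_toggle_of_le le_rfl]; simp)

theorem jwGen_mul_self (j : ι) : jwGen j * jwGen j = 1 := by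
  ext ψ S
  change jwGen j (jwGen j ψ) S = ψ S
  rw [jwGen_apply, jwGen_apply, jwSign_toggle_of_le le_rfl, toggle_toggle, ← mul_assoc]
  rcases Int.units_eq_one_or (jwSign j S) with h | h <;> simp [h]

theorem jwGen_anticomm {j k : ι} (h : j ≠ k) : jwGen j * jwGen k = -(jwGen k * jwGen j) := by
  wlog hjk : j < k generalizing j k
  · rw [this h.symm (lt_of_le_of_ne (not_lt.1 hjk) h.symm), neg_neg]
  ext ψ S
  change jwGen j (jwGen k ψ) S = -(jwGen k (jwGen j ψ) S)
  rw [jwGen_apply, jwGen_apply, jwGen_apply, jwGen_apply, jwSign_toggle_of_lt hjk,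
    jwSign_toggle_of_le hjk.le, toggle_comm]
  push_cast
  ring

theorem jwGen_single (j : ι) (S : Finset ι) (z : ℂ) :
    jwGen j (lp.single 2 S z) = jwSign j S • lp.single 2 (toggle j S) z := by
  ext T
  rw [jwGen_apply, lp.single_apply]
  by_cases hT : T = toggle j S
  · subst hT
    rw [toggle_toggle, jwSign_toggle_of_le le_rfl]
    rcases Int.units_eq_one_or (jwSign j S) with h | h <;> simp [h]
  · have hT' : toggle j T ≠ S := fun h => hT (by rw [← h, toggle_toggle])
    rw [Pi.single_eq_of_ne hT', mul_zero]
    rcases Int.units_eq_one_or (jwSign j S) with h | h <;> simp [h, Pi.single_eq_of_ne hT]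

end JordanWigner

/-! ### Extending Clifford generators from a basis to a real Hilbert space. -/

section CliffordExtension

/-- The hypothesis says `‖T v‖² + ‖S v‖² = r² ‖v‖²`. It is applied with `S = 0` to Clifford elements
and with `S = star T` to annihilators. -/
theorem norm_le_of_star_mul_self_le {H : Type*} [NormedAddCommGroup H] [InnerProductSpace ℂ H]
    [CompleteSpace H] {T : H →L[ℂ] H} {r : ℝ} (hr : 0 ≤ r) (S : H →L[ℂ] H)
    (h : star T * T + star S * S = ((r ^ 2 : ℝ) : ℂ) • 1) : ‖T‖ ≤ r := by
  refine T.opNorm_le_bound hr fun v => abs_le_of_sq_le_sq' ?_ (by positivity) |>.2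
  have h1 := congrArg (fun R : H →L[ℂ] H => (inner ℂ v (R v)).re) h
  simp only [add_apply, mul_apply_eq_comp,
    ContinuousLinearMap.star_eq_adjoint, ContinuousLinearMap.adjoint_inner_right, inner_add_right,
    smul_apply, one_apply_eq_self, inner_smul_right,
    inner_self_eq_norm_sq_to_K, Complex.add_re, Complex.coe_algebraMap] at h1
  norm_cast at h1
  rw [mul_pow, ← h1]
  nlinarith [sq_nonneg ‖S v‖]

variable {ι V H : Type*} [NormedAddCommGroup V] [InnerProductSpace ℝ V]
  [NormedAddCommGroup H] [InnerProductSpace ℂ H]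

theorem linearCombination_anticomm {c : ι → H →L[ℂ] H} (hsq : ∀ i, c i * c i = 1)
    (hanti : ∀ i j, i ≠ j → c i * c j = -(c j * c i)) {b : ι → V} (hb : Orthonormal ℝ b)
    (f g : ι →₀ ℝ) :
    Finsupp.linearCombination ℝ c f * Finsupp.linearCombination ℝ c g +
      Finsupp.linearCombination ℝ c g * Finsupp.linearCombination ℝ c f =
    ((2 * inner ℝ (Finsupp.linearCombination ℝ b f) (Finsupp.linearCombination ℝ b g) : ℝ) : ℂ) •
      1 := by
  classical
  induction f using Finsupp.induction_linear with
  | zero => simp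
  | add f f' hf hf' =>
    rw [map_add, map_add, inner_add_left, mul_add 2, Complex.ofReal_add, add_smul, ← hf, ← hf']
    noncomm_ring
  | single i r =>
    induction g using Finsupp.induction_linear with
    | zero => simp
    | add g g' hg hg' =>
      rw [map_add, map_add, inner_add_right, mul_add 2, Complex.ofReal_add, add_smul, ← hg, ← hg']
      noncomm_ring
    | single j s =>
      simp only [Finsupp.linearCombination_single, smul_mul_smul_comm, inner_smul_left,
        inner_smul_right, orthonormal_iff_ite.1 hb]
      by_cases hij : i = j
      · subst hij
        rw [hsq, ← Complex.coe_smul, ← Complex.coe_smul, ← add_smul]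
        congr 1
        simp
        ring
      · rw [hanti i j hij, mul_comm s r]
        simp [hij]

/-- On the dense span of the basis the relation with `f = g` reads `(L f)² = ‖e f‖²`, so `L` is
bounded and extends by continuity; self-adjointness and the anticommutator are closed conditions. -/
theorem exists_clifford_extension [CompleteSpace H] {c : ι → H →L[ℂ] H} (hstar : ∀ i, star (c i) = c i)
    (hsq : ∀ i, c i * c i = 1) (hanti : ∀ i j, i ≠ j → c i * c j = -(c j * c i))
    (b : HilbertBasis ι ℝ V) :
    ∃ C : V →L[ℝ] (H →L[ℂ] H), (∀ i, C (b i) = c i) ∧ (∀ f, star (C f) = C f) ∧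
      ∀ f g, C f * C g + C g * C f = ((2 * inner ℝ f g : ℝ) : ℂ) • 1 := by
  set L := Finsupp.linearCombination ℝ c
  set e := Finsupp.linearCombination ℝ b
  have hdense : DenseRange e := by
    have := b.dense_span
    rw [← Finsupp.range_linearCombination] at this
    exact (LinearMap.range e).dense_iff_topologicalClosure_eq_top.2 this
  have hLstar : ∀ f, star (L f) = L f := fun f => by
    simp [L, Finsupp.linearCombination_apply, Finsupp.sum, star_sum, star_smul, hstar]
  have hL := linearCombination_anticomm hsq hanti b.orthonormal
  have hnorm : ∀ f, ‖L f‖ ≤ 1 * ‖e f‖ := fun f => by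
    rw [one_mul]
    refine norm_le_of_star_mul_self_le (norm_nonneg _) 0 ?_
    have := hL f f
    rw [real_inner_self_eq_norm_sq, ← two_smul ℂ, Complex.ofReal_mul, mul_smul] at this
    rw [hLstar, mul_zero, add_zero]
    exact smul_right_injective _ (two_ne_zero (α := ℂ)) this
  have hext : ∀ f, L.extendOfNorm e (e f) = L f :=
    LinearMap.extendOfNorm_eq hdense ⟨1, hnorm⟩
  refine ⟨L.extendOfNorm e, fun i => ?_, fun f => ?_, fun f g => ?_⟩
  · have := hext (Finsupp.single i 1)
    simpa [L, e] using this
  · refine hdense.induction_on (p := fun f => star (L.extendOfNorm e f) = L.extendOfNorm e f) f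
      (isClosed_eq (by fun_prop) (by fun_prop)) fun f => by rw [hext, hLstar]
  · refine hdense.induction_on₂ (p := fun f g => L.extendOfNorm e f * L.extendOfNorm e g +
        L.extendOfNorm e g * L.extendOfNorm e f = ((2 * inner ℝ f g : ℝ) : ℂ) • 1)
      (isClosed_eq (by fun_prop) (by fun_prop)) (fun f g => ?_) f g
    rw [hext, hext, hL]

end CliffordExtension

/-! ### The algebra `*CAR` and its Clifford generators. -/

namespace StarCAR

variable {K : Type*} [NormedAddCommGroup K] [InnerProductSpace ℂ K]

/-- The generator `a(f)` of `*CAR`. -/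
def annihilator (f : K) : StarCAR K := PresentedStarAlg.mk (CARRel K) (FreeStarAlg.gen f)

theorem annihilator_add (f g : K) : annihilator (f + g) = annihilator f + annihilator g := by
  rw [annihilator, PresentedStarAlg.mk_rel (CARRel.add f g), map_add, annihilator, annihilator]

theorem annihilator_smul (z : ℂ) (f : K) :
    annihilator (z • f) = starRingEnd ℂ z • annihilator f := by
  rw [annihilator, PresentedStarAlg.mk_rel (CARRel.smul z f), map_smul, annihilator]

theorem annihilator_anticomm (f g : K) :
    annihilator f * annihilator g + annihilator g * annihilator f = 0 := by
  simpa [annihilator] using PresentedStarAlg.mk_rel (CARRel.anticomm f g)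

theorem annihilator_anticomm_star (f g : K) :
    annihilator f * star (annihilator g) + star (annihilator g) * annihilator f =
      (inner ℂ f g : ℂ) • 1 := by
  have := PresentedStarAlg.mk_rel (CARRel.anticomm_star f g)
  simpa only [annihilator, map_add, map_mul, map_star, map_smul, map_one] using this

theorem induction {motive : StarCAR K → Prop}
    (scalar : ∀ z : ℂ, motive (algebraMap ℂ (StarCAR K) z))
    (gen : ∀ f, motive (annihilator f)) (genStar : ∀ f, motive (star (annihilator f)))
    (mul : ∀ a b, motive a → motive b → motive (a * b))
    (add : ∀ a b, motive a → motive b → motive (a + b)) (a : StarCAR K) : motive a := by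
  obtain ⟨p, rfl⟩ := PresentedStarAlg.mk_surjective _ a
  induction p using FreeStarAlg.induction with
  | scalar z => rw [AlgHomClass.commutes]; exact scalar z
  | gen f => exact gen f
  | genStar f => rw [← FreeStarAlg.star_gen, map_star]; exact genStar f
  | mul a b ha hb => rw [map_mul]; exact mul _ _ ha hb
  | add a b ha hb => rw [map_add]; exact add _ _ ha hb

/-- The self-adjoint Clifford generator `a(f) + a(f)*`. -/
def clifford (f : K) : StarCAR K := annihilator f + star (annihilator f)

theorem clifford_add (f g : K) : clifford (f + g) = clifford f + clifford g := by
  rw [clifford, annihilator_add, star_add, clifford, clifford]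
  abel

theorem clifford_ofReal_smul (r : ℝ) (f : K) :
    clifford ((r : ℂ) • f) = (r : ℂ) • clifford f := by
  rw [clifford, annihilator_smul, star_smul, clifford, smul_add]
  simp

theorem clifford_anticomm (f g : K) :
    clifford f * clifford g + clifford g * clifford f =
      ((2 * (inner ℂ f g).re : ℝ) : ℂ) • 1 := by
  have h1 := annihilator_anticomm f g
  have h2 := congrArg star h1
  have h3 := annihilator_anticomm_star f g
  have h4 := annihilator_anticomm_star g f
  rw [star_add, star_mul, star_mul, star_zero] at h2
  have h5 : ((2 * (inner ℂ f g).re : ℝ) : ℂ) = inner ℂ f g + inner ℂ g f := by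
    rw [← inner_conj_symm g f, Complex.add_conj]
  rw [h5, add_smul, ← h3, ← h4, clifford, clifford, ← sub_eq_zero]
  calc _ = (annihilator f * annihilator g + annihilator g * annihilator f) +
        (star (annihilator g) * star (annihilator f) +
          star (annihilator f) * star (annihilator g)) := by noncomm_ring
    _ = 0 := by rw [h1, h2, add_zero]

/-- By antilinearity, `i (a(if) + a(if)*) = a(f) - a(f)*`. -/
theorem annihilator_eq (f : K) :
    annihilator f = (1 / 2 : ℂ) • (clifford f + Complex.I • clifford (Complex.I • f)) := by
  rw [clifford, clifford, annihilator_smul, star_smul, Complex.conj_I]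
  match_scalars
  · simp
    norm_num
  · simp

section Lift

variable {A : Type*} [Ring A] [Algebra ℂ A] [StarRing A] [StarModule ℂ A]

/-- The *-homomorphism defined by a family of elements satisfying the CAR. -/
def lift (a : K → A) (hadd : ∀ f g, a (f + g) = a f + a g)
    (hsmul : ∀ (z : ℂ) f, a (z • f) = starRingEnd ℂ z • a f)
    (hanti : ∀ f g, a f * a g + a g * a f = 0)
    (hstar : ∀ f g, a f * star (a g) + star (a g) * a f = (inner ℂ f g : ℂ) • 1) :
    StarCAR K →⋆ₐ[ℂ] A :=
  PresentedStarAlg.lift (FreeStarAlg.lift a) (by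
    intro p q h
    cases h with
    | add f g => simp [FreeStarAlg.lift_gen, hadd]
    | smul z f => simp only [map_smul, FreeStarAlg.lift_gen, hsmul]
    | anticomm f g => simp [FreeStarAlg.lift_gen, hanti]
    | anticomm_star f g =>
      simp only [map_add, map_mul, map_star, map_smul, map_one, FreeStarAlg.lift_gen, hstar])

theorem lift_annihilator (a : K → A) (hadd : ∀ f g, a (f + g) = a f + a g)
    (hsmul : ∀ (z : ℂ) f, a (z • f) = starRingEnd ℂ z • a f)
    (hanti : ∀ f g, a f * a g + a g * a f = 0)
    (hstar : ∀ f g, a f * star (a g) + star (a g) * a f = (inner ℂ f g : ℂ) • 1) (f : K) :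
    lift a hadd hsmul hanti hstar (annihilator f) = a f := by
  rw [lift, annihilator, PresentedStarAlg.lift_mk, FreeStarAlg.lift_gen]

/-- The formula of `annihilator_eq` is taken as the definition of `a f`. -/
theorem exists_hom_of_clifford (C : K → A) (hadd : ∀ f g, C (f + g) = C f + C g)
    (hsmul : ∀ (r : ℝ) f, C ((r : ℂ) • f) = (r : ℂ) • C f) (hstar : ∀ f, star (C f) = C f)
    (hanti : ∀ f g, C f * C g + C g * C f = ((2 * (inner ℂ f g).re : ℝ) : ℂ) • 1) :
    ∃ π : StarCAR K →⋆ₐ[ℂ] A, ∀ f, π (clifford f) = C f := by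
  have hneg : ∀ f, C (Complex.I • Complex.I • f) = -C f := fun f => by
    have := hsmul (-1) f
    rw [smul_smul, Complex.I_mul_I]
    simpa using this
  set a : K → A := fun f => (1 / 2 : ℂ) • (C f + Complex.I • C (Complex.I • f)) with ha
  have hastar : ∀ f, star (a f) = (1 / 2 : ℂ) • (C f - Complex.I • C (Complex.I • f)) :=
    fun f => by
      simp only [ha, star_smul, star_add, hstar]
      simp [sub_eq_add_neg]
  have hsum : ∀ f, a f + star (a f) = C f := fun f => by
    rw [hastar, ha]
    match_scalars <;> norm_num
  -- One computation serves both relations: `s = t = i` gives `{a f, a g} = 0`, and `s = i`, `t =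
  -- -i` gives `{a f, (a g)*} = (f, g)`.
  have expand : ∀ (s t : ℂ) (f g : K),
      ((1 / 2 : ℂ) • (C f + s • C (Complex.I • f))) * ((1 / 2 : ℂ) • (C g + t • C (Complex.I • g)))
      + ((1 / 2 : ℂ) • (C g + t • C (Complex.I • g))) *
        ((1 / 2 : ℂ) • (C f + s • C (Complex.I • f))) =
      ((1 / 2) * ((inner ℂ f g).re - t * (inner ℂ f g).im + s * (inner ℂ f g).im
        + s * t * (inner ℂ f g).re)) • (1 : A) := fun s t f g => by
    calc _ = (1 / 4 : ℂ) • ((C f * C g + C g * C f) +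
          t • (C f * C (Complex.I • g) + C (Complex.I • g) * C f) +
          s • (C (Complex.I • f) * C g + C g * C (Complex.I • f)) +
          (s * t) • (C (Complex.I • f) * C (Complex.I • g) +
            C (Complex.I • g) * C (Complex.I • f))) := by
          simp only [mul_add, add_mul, smul_mul_assoc, mul_smul_comm]
          match_scalars <;> ring
      _ = _ := by
          rw [hanti, hanti, hanti, hanti]
          simp only [inner_smul_left, inner_smul_right, smul_smul, ← add_smul]
          congr 1
          simp
          ring
  refine ⟨lift a ?_ ?_ ?_ ?_, fun f => ?_⟩
  · intro f g
    simp only [ha, smul_add, hadd]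
    abel
  · intro z f
    have h1 : ∀ f, C (z • f) = (z.re : ℂ) • C f + (z.im : ℂ) • C (Complex.I • f) := fun f => by
      rw [← hsmul, ← hsmul, ← hadd, smul_smul, ← add_smul, Complex.re_add_im]
    have h2 : starRingEnd ℂ z = z.re - z.im * Complex.I := by
      apply Complex.ext <;> simp
    have h3 : Complex.I * Complex.I = -1 := Complex.I_mul_I
    simp only [ha]
    rw [smul_comm Complex.I z f, h1, h1, hneg, h2]
    match_scalars
    · ring
    · linear_combination (1 / 2 * z.im : ℂ) * h3
  · intro f g
    rw [expand Complex.I Complex.I f g, Complex.I_mul_I]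
    simp
  · intro f g
    rw [hastar, sub_eq_add_neg, ← neg_smul, expand Complex.I (-Complex.I) f g]
    congr 1
    rw [mul_neg, Complex.I_mul_I]
    conv_rhs => rw [← Complex.re_add_im (inner ℂ f g)]
    ring
  · rw [clifford, map_add, map_star, lift_annihilator, hsum]

end Lift

/-- The CAR force `‖π (a f)‖ ≤ ‖f‖` in every representation. A bound independent of `π` is what
allows infinite direct sums, over bases and over the sites of `X`. -/
theorem exists_norm_le (x : StarCAR K) : ∃ M : ℝ, ∀ (H : Type v) [NormedAddCommGroup H]
    [InnerProductSpace ℂ H] [CompleteSpace H] (π : StarCAR K →⋆ₐ[ℂ] (H →L[ℂ] H)), ‖π x‖ ≤ M := by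
  have hgen : ∀ (f : K) (H : Type v) [NormedAddCommGroup H]
      [InnerProductSpace ℂ H] [CompleteSpace H] (π : StarCAR K →⋆ₐ[ℂ] (H →L[ℂ] H)),
      ‖π (annihilator f)‖ ≤ ‖f‖ := fun f H _ _ _ π => by
    refine norm_le_of_star_mul_self_le (norm_nonneg _) (star (π (annihilator f))) ?_
    rw [star_star, ← map_star, ← map_mul, ← map_mul, ← map_add, add_comm,
      annihilator_anticomm_star, map_smul, map_one, inner_self_eq_norm_sq_to_K]
    simp
  induction x using StarCAR.induction with
  | scalar z =>
    refine ⟨‖z‖, fun H _ _ _ π => ?_⟩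
    rw [AlgHomClass.commutes, Algebra.algebraMap_eq_smul_one]
    exact (norm_smul_le _ _).trans
      (mul_le_of_le_one_right (norm_nonneg _) ContinuousLinearMap.norm_id_le)
  | gen f => exact ⟨‖f‖, fun H _ _ _ π => hgen f H π⟩
  | genStar f => exact ⟨‖f‖, fun H _ _ _ π => by rw [map_star, norm_star]; exact hgen f H π⟩
  | mul a b ha hb =>
    obtain ⟨M, hM⟩ := ha
    obtain ⟨N, hN⟩ := hb
    refine ⟨|M| * |N|, fun H _ _ _ π => ?_⟩
    rw [map_mul]
    exact (norm_mul_le _ _).trans (mul_le_mul ((hM H π).trans (le_abs_self _))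
      ((hN H π).trans (le_abs_self _)) (norm_nonneg _) (abs_nonneg _))
  | add a b ha hb =>
    obtain ⟨M, hM⟩ := ha
    obtain ⟨N, hN⟩ := hb
    refine ⟨M + N, fun H _ _ _ π => ?_⟩
    rw [map_add]
    exact (norm_add_le _ _).trans (add_le_add (hM H π) (hN H π))

/-! ### A faithful representation of `*CAR`, with `K` as a real Hilbert space. -/

section RealStructure

attribute [local instance] InnerProductSpace.complexToReal

theorem exists_jordanWigner_rep [CompleteSpace K] {ι : Type*} [LinearOrder ι]
    (b : HilbertBasis ι ℝ K) :
    ∃ π : StarCAR K →⋆ₐ[ℂ]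
      (lp (fun _ : Finset ι => ℂ) 2 →L[ℂ] lp (fun _ : Finset ι => ℂ) 2),
      ∀ i, π (clifford (b i)) = jwGen i := by
  obtain ⟨C, hC, hstar, hanti⟩ := exists_clifford_extension star_jwGen jwGen_mul_self
    (fun _ _ => jwGen_anticomm) b
  obtain ⟨π, hπ⟩ := exists_hom_of_clifford C (map_add C)
    (fun r f => by rw [Complex.coe_smul, Complex.coe_smul, map_smul]; rfl) hstar hanti
  exact ⟨π, fun i => by rw [hπ, hC]⟩

/-- The basis vector at `∅` is separating: it corresponds to the empty product `1`, so `π x` sends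
it to a list of coefficients expressing `x` in ordered products. Linear independence of the ordered
products is never needed. -/
theorem eq_zero_of_jordanWigner_rep {ι : Type*} [LinearOrder ι] {b : ι → K}
    (hb : Orthonormal ℝ b)
    {π : StarCAR K →⋆ₐ[ℂ] (lp (fun _ : Finset ι => ℂ) 2 →L[ℂ] lp (fun _ : Finset ι => ℂ) 2)}
    (hπ : ∀ i, π (clifford (b i)) = jwGen i) {x : StarCAR K}
    (hx : x ∈ Algebra.adjoin ℂ (Set.range fun i => clifford (b i))) (h : π x = 0) : x = 0 := by
  set e : ι → StarCAR K := fun i => clifford (b i)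
  have hanti : ∀ i j, e i * e j + e j * e i = if i = j then (2 : ℂ) • 1 else 0 := fun i j => by
    have h1 : (inner ℂ (b i) (b j)).re = if i = j then 1 else 0 :=
      orthonormal_iff_ite.1 hb i j
    rw [clifford_anticomm, h1]
    split_ifs <;> simp
  have hsq : ∀ i, e i * e i = 1 := fun i => by
    have := hanti i i
    rw [if_pos rfl, ← two_smul ℂ] at this
    exact smul_right_injective _ (two_ne_zero (α := ℂ)) this
  have hne : ∀ i j, i ≠ j → e i * e j = -(e j * e i) := fun i j hij =>
    eq_neg_of_add_eq_zero_left (by rw [hanti, if_neg hij])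
  set Φ : (Finset ι →₀ ℂ) →ₗ[ℂ] StarCAR K := Finsupp.linearCombination ℂ (orderedProd e)
  set J : (Finset ι →₀ ℂ) →ₗ[ℂ] lp (fun _ : Finset ι => ℂ) 2 :=
    Finsupp.linearCombination ℂ (fun S => lp.single 2 S 1)
  have hJ : ∀ v S, J v S = v S := fun v S => by
    induction v using Finsupp.induction_linear with
    | zero => simp
    | add v w hv hw => simp [hv, hw]
    | single T z =>
      simp [J, Pi.single_apply, Finsupp.single_apply, eq_comm]
  replace hπ : ∀ i, π (e i) = jwGen i := hπ
  -- Left multiplication by `x` and the operator `π x` are followed on the same formal combination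
  -- `v` of finite sets, through `Φ` and `J`; only `J` has to be injective.
  have key : ∀ v, ∃ v', π x (J v) = J v' ∧ Φ v' = x * Φ v := by
    clear h
    induction hx using Algebra.adjoin_induction with
    | mem y hy =>
      obtain ⟨i, rfl⟩ := hy
      intro v
      induction v using Finsupp.induction_linear with
      | zero => exact ⟨0, by simp⟩
      | add v w hv hw =>
        obtain ⟨v', h1, h2⟩ := hv
        obtain ⟨w', h3, h4⟩ := hw
        exact ⟨v' + w', by simp only [map_add, h1, h3], by simp only [map_add, h2, h4, mul_add]⟩
      | single S z =>
        refine ⟨Finsupp.single (toggle i S) ((jwSign i S : ℤ) * z), ?_, ?_⟩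
        · simp only [J, Finsupp.linearCombination_single, map_smul, hπ, jwGen_single]
          rcases Int.units_eq_one_or (jwSign i S) with h | h <;> simp [h]
        · simp only [Φ, Finsupp.linearCombination_single, mul_smul_comm,
            mul_orderedProd e hsq hne]
          rcases Int.units_eq_one_or (jwSign i S) with h | h <;> simp [h]
    | algebraMap z =>
      intro v
      refine ⟨z • v, ?_, ?_⟩
      · rw [AlgHomClass.commutes, map_smul, Algebra.algebraMap_eq_smul_one]
        rfl
      · rw [map_smul, Algebra.smul_def]
    | add y z _ _ hy hz =>
      intro v
      obtain ⟨v', h1, h2⟩ := hy v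
      obtain ⟨w', h3, h4⟩ := hz v
      exact ⟨v' + w', by rw [map_add, map_add, ← h1, ← h3]; rfl, by rw [map_add, h2, h4, add_mul]⟩
    | mul y z _ _ hy hz =>
      intro v
      obtain ⟨v', h1, h2⟩ := hz v
      obtain ⟨w', h3, h4⟩ := hy v'
      exact ⟨w', by rw [map_mul, ← h3, ← h1]; rfl, by rw [h4, h2, mul_assoc]⟩
  obtain ⟨v', h1, h2⟩ := key (Finsupp.single ∅ 1)
  have h3 : v' = 0 := by
    ext S
    rw [← hJ, ← h1, h]
    rfl
  rw [h3, map_zero] at h2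
  simpa [Φ, orderedProd_empty] using h2.symm

theorem exists_finite_mem_adjoin (x : StarCAR K) :
    ∃ t : Set K, t.Finite ∧ x ∈ Algebra.adjoin ℂ (clifford '' t) := by
  have hgen : ∀ f : K, annihilator f ∈ Algebra.adjoin ℂ (clifford '' {f, Complex.I • f}) ∧
      star (annihilator f) ∈ Algebra.adjoin ℂ (clifford '' {f, Complex.I • f}) := fun f => by
    have h1 : clifford f ∈ Algebra.adjoin ℂ (clifford '' {f, Complex.I • f}) :=
      Algebra.subset_adjoin ⟨f, by simp, rfl⟩
    have h2 : annihilator f ∈ Algebra.adjoin ℂ (clifford '' {f, Complex.I • f}) := by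
      have h3 : clifford (Complex.I • f) ∈ Algebra.adjoin ℂ (clifford '' {f, Complex.I • f}) :=
        Algebra.subset_adjoin ⟨Complex.I • f, by simp, rfl⟩
      rw [annihilator_eq]
      exact Subalgebra.smul_mem _ (add_mem h1 (Subalgebra.smul_mem _ h3 _)) _
    refine ⟨h2, ?_⟩
    have : star (annihilator f) = clifford f - annihilator f := by rw [clifford]; abel
    rw [this]
    exact sub_mem h1 h2
  induction x using StarCAR.induction with
  | scalar z => exact ⟨∅, Set.finite_empty, Subalgebra.algebraMap_mem _ _⟩
  | gen f => exact ⟨{f, Complex.I • f}, by simp, (hgen f).1⟩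
  | genStar f => exact ⟨{f, Complex.I • f}, by simp, (hgen f).2⟩
  | mul a b ha hb =>
    obtain ⟨s, hs, ha⟩ := ha
    obtain ⟨t, ht, hb⟩ := hb
    exact ⟨s ∪ t, hs.union ht,
      mul_mem (Algebra.adjoin_mono (Set.image_mono Set.subset_union_left) ha)
        (Algebra.adjoin_mono (Set.image_mono Set.subset_union_right) hb)⟩
  | add a b ha hb =>
    obtain ⟨s, hs, ha⟩ := ha
    obtain ⟨t, ht, hb⟩ := hb
    exact ⟨s ∪ t, hs.union ht,
      add_mem (Algebra.adjoin_mono (Set.image_mono Set.subset_union_left) ha)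
        (Algebra.adjoin_mono (Set.image_mono Set.subset_union_right) hb)⟩

/-- Only finitely many vectors occur in `x`. An orthonormal basis of their real span extends to a
Hilbert basis, and as `clifford` is real-linear, finite combinations of basis elements suffice,
without closure. -/
theorem exists_hilbertBasis_mem_adjoin [CompleteSpace K] (x : StarCAR K) :
    ∃ (w : Set K) (b : HilbertBasis w ℝ K), ⇑b = ((↑) : w → K) ∧
      x ∈ Algebra.adjoin ℂ (Set.range fun i => clifford (b i)) := by
  obtain ⟨t, ht, hx⟩ := exists_finite_mem_adjoin x
  have : FiniteDimensional ℝ (Submodule.span ℝ t) := FiniteDimensional.span_of_finite ℝ ht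
  set e := stdOrthonormalBasis ℝ (Submodule.span ℝ t)
  have he : Orthonormal ℝ (fun i => (e i : K)) :=
    e.orthonormal.comp_linearIsometry (Submodule.span ℝ t).subtypeₗᵢ
  obtain ⟨w, b, hw, hb⟩ := he.toSubtypeRange.exists_hilbertBasis_extension
  refine ⟨w, b, hb, ?_⟩
  set S : Submodule ℝ K :=
    { carrier := {f | clifford f ∈ Algebra.adjoin ℂ (Set.range fun i => clifford (b i))}
      zero_mem' := by
        have : clifford (0 : K) = 0 := by simpa using clifford_ofReal_smul 0 (0 : K)
        simp [this]
      add_mem' := fun {f g} hf hg => by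
        rw [Set.mem_ofPred_eq, clifford_add]
        exact add_mem hf hg
      smul_mem' := fun r f hf => by
        rw [Set.mem_ofPred_eq, ← Complex.coe_smul, clifford_ofReal_smul]
        exact Subalgebra.smul_mem _ hf _ }
  refine Algebra.adjoin_le ?_ hx
  rintro _ ⟨f, hf, rfl⟩
  change f ∈ S
  have h1 := congrArg Subtype.val (e.sum_repr ⟨f, Submodule.subset_span hf⟩)
  rw [← show _ = f from h1, AddSubmonoidClass.coe_finsetSum]
  refine S.sum_mem fun i _ => S.smul_mem _ ?_
  exact Algebra.subset_adjoin ⟨⟨e i, hw ⟨i, rfl⟩⟩, by simp only [hb]⟩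

theorem exists_faithful_rep {K : Type u} [NormedAddCommGroup K] [InnerProductSpace ℂ K]
    [CompleteSpace K] : ∃ (H : Type u) (_ : NormedAddCommGroup H) (_ : InnerProductSpace ℂ H)
      (_ : CompleteSpace H) (π : StarCAR K →⋆ₐ[ℂ] (H →L[ℂ] H)), Function.Injective π := by
  classical
  -- One order on `K` restricts to every basis `w` and provides the Jordan–Wigner signs.
  let _ : LinearOrder K := linearOrderOfSTO WellOrderingRel
  -- Bases are indexed by their underlying sets, so the sum is over a type in the universe of `K`.
  choose b hb using fun w : {w : Set K // ∃ b : HilbertBasis w ℝ K, ⇑b = ((↑) : w → K)} => w.2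
  choose ρ hρ using fun w => exists_jordanWigner_rep (b w)
  refine ⟨_, _, _, inferInstance,
    directSumRep ρ (fun a => (exists_norm_le a).imp fun M h i => h _ (ρ i)),
    (injective_iff_map_eq_zero _).2 fun x hx => ?_⟩
  obtain ⟨w, b', hb', hxw⟩ := exists_hilbertBasis_mem_adjoin x
  refine eq_zero_of_jordanWigner_rep (b ⟨w, b', hb'⟩).orthonormal (hρ ⟨w, b', hb'⟩) ?_
    (eq_zero_of_directSumRep_eq_zero hx _)
  rw [hb]
  rwa [hb'] at hxw

end RealStructure

end StarCAR

/-! ### Normal forms in `𝓑`. -/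

namespace FieldStarAlg

variable {K X : Type*} [NormedAddCommGroup K] [InnerProductSpace ℂ K] [AddCommGroup X]
  (σ : X →+ X →+ ℝ) (β : Multiplicative X →* (StarCAR K ≃⋆ₐ[ℂ] StarCAR K))

theorem weyl_zero : weyl σ β 0 = 1 := by
  rw [weyl, PresentedStarAlg.mk_rel FieldRel.weyl_zero, map_one]

theorem star_weyl (x : X) : star (weyl σ β x) = weyl σ β (-x) := by
  rw [weyl, ← map_star, PresentedStarAlg.mk_rel (FieldRel.weyl_star x), weyl]

theorem weyl_mul_weyl (x y : X) : weyl σ β x * weyl σ β y =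
    Complex.exp (-(Complex.I / 2) * (σ x y : ℂ)) • weyl σ β (x + y) := by
  rw [weyl, weyl, ← map_mul, PresentedStarAlg.mk_rel (FieldRel.weyl_mul x y), map_smul, weyl]

/-- The map `C ↦ ∑ x, C x * W(x)`. -/
def normalForm : (X →₀ StarCAR K) →+ FieldStarAlg σ β :=
  Finsupp.liftAddHom fun x =>
    (AddMonoidHom.mulRight (weyl σ β x)).comp (ofCAR σ β : StarCAR K →+ FieldStarAlg σ β)

theorem normalForm_apply (C : X →₀ StarCAR K) :
    normalForm σ β C = C.sum fun x c => ofCAR σ β c * weyl σ β x :=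
  rfl

theorem normalForm_single (x : X) (c : StarCAR K) :
    normalForm σ β (Finsupp.single x c) = ofCAR σ β c * weyl σ β x := by
  simp [normalForm_apply]

/-- The range contains the generators and their adjoints and is closed under products, because `c
W(x) d W(y)` equals `c β_x(d) W(x + y)` up to a phase. -/
theorem normalForm_surjective : Function.Surjective (normalForm σ β) := by
  have hcar : ∀ c, ∃ C, normalForm σ β C = ofCAR σ β c := fun c =>
    ⟨Finsupp.single 0 c, by rw [normalForm_single, weyl_zero, mul_one]⟩
  have hweyl : ∀ x, ∃ C, normalForm σ β C = weyl σ β x := fun x =>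
    ⟨Finsupp.single x 1, by rw [normalForm_single, map_one, one_mul]⟩
  have hann : ∀ f, PresentedStarAlg.mk (FieldRel σ β) (FreeStarAlg.gen (Sum.inl f)) =
      ofCAR σ β (StarCAR.annihilator f) := fun f => by
    rw [StarCAR.annihilator, ofCAR_mk, carPoly, FreeStarAlg.lift_gen]
  intro b
  obtain ⟨p, rfl⟩ := PresentedStarAlg.mk_surjective _ b
  induction p using FreeStarAlg.induction with
  | scalar z =>
    rw [AlgHomClass.commutes, ← AlgHomClass.commutes (ofCAR σ β)]
    exact hcar _
  | gen s =>
    rcases s with f | x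
    · rw [hann]
      exact hcar _
    · exact hweyl x
  | genStar s =>
    rw [← FreeStarAlg.star_gen, map_star]
    rcases s with f | x
    · rw [hann, ← map_star]
      exact hcar _
    · change ∃ C, _ = star (weyl σ β x)
      rw [star_weyl]
      exact hweyl _
  | add a b ha hb =>
    obtain ⟨C, hC⟩ := ha
    obtain ⟨D, hD⟩ := hb
    exact ⟨C + D, by rw [map_add, map_add, hC, hD]⟩
  | mul a b ha hb =>
    obtain ⟨C, hC⟩ := ha
    obtain ⟨D, hD⟩ := hb
    rw [map_mul, ← hC, ← hD]
    clear hC hD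
    induction C using Finsupp.induction_linear with
    | zero => exact ⟨0, by simp⟩
    | add C C' hC hC' =>
      obtain ⟨E, hE⟩ := hC
      obtain ⟨E', hE'⟩ := hC'
      exact ⟨E + E', by rw [map_add, map_add, add_mul, hE, hE']⟩
    | single x c =>
      induction D using Finsupp.induction_linear with
      | zero => exact ⟨0, by simp⟩
      | add D D' hD hD' =>
        obtain ⟨E, hE⟩ := hD
        obtain ⟨E', hE'⟩ := hD'
        exact ⟨E + E', by rw [map_add, map_add, mul_add, hE, hE']⟩
      | single y d =>
        refine ⟨Finsupp.single (x + y) (Complex.exp (-(Complex.I / 2) * (σ x y : ℂ)) •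
          (c * β (Multiplicative.ofAdd x) d)), ?_⟩
        rw [normalForm_single, normalForm_single, normalForm_single, map_smul, map_mul,
          smul_mul_assoc, ← mul_smul_comm, ← weyl_mul_weyl, mul_assoc, mul_assoc,
          ← mul_assoc (ofCAR σ β _) (weyl σ β x), ← weyl_mul_ofCAR, mul_assoc]

/-! ### The representation of `𝓑` on `ℓ²(X, H₀)`. -/

section Representation

variable {H₀ : Type*} [NormedAddCommGroup H₀] [InnerProductSpace ℂ H₀]

/-- The Weyl operators on `ℓ²(X, H₀)`. -/
def weylOp (x : X) : lp (fun _ : X => H₀) 2 →L[ℂ] lp (fun _ : X => H₀) 2 :=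
  weightedPerm (Equiv.subRight x) (fun y => Complex.exp (-(Complex.I / 2) * (σ x y : ℂ)))
    (fun y => by simp [Complex.norm_exp])

theorem weylOp_apply (x : X) (ψ : lp (fun _ : X => H₀) 2) (y : X) :
    weylOp σ x ψ y = Complex.exp (-(Complex.I / 2) * (σ x y : ℂ)) • ψ (y - x) :=
  rfl

theorem weylOp_zero : weylOp (H₀ := H₀) σ (0 : X) = 1 := by
  ext ψ y
  rw [weylOp_apply]
  simp

theorem weylOp_mul (hσ : ∀ x y, σ x y = -σ y x) (x y : X) :
    weylOp (H₀ := H₀) σ x * weylOp σ y =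
      Complex.exp (-(Complex.I / 2) * (σ x y : ℂ)) • weylOp σ (x + y) := by
  ext ψ z
  change weylOp σ x (weylOp σ y ψ) z =
    Complex.exp (-(Complex.I / 2) * (σ x y : ℂ)) • weylOp σ (x + y) ψ z
  -- The second phase is evaluated at `z - x`; its extra term `-σ y x` is `σ x y` by antisymmetry,
  -- the cocycle of the Weyl relation.
  rw [weylOp_apply, weylOp_apply, weylOp_apply, smul_smul, smul_smul, ← Complex.exp_add,
    ← Complex.exp_add, sub_sub, map_sub, hσ y x, map_add, AddMonoidHom.add_apply]
  congr 2
  push_cast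
  ring

variable [CompleteSpace H₀]

/-- The representation of `*CAR` on `ℓ²(X, H₀)` induced by a representation on `H₀` and `β`. -/
def carRep (π₀ : StarCAR K →⋆ₐ[ℂ] (H₀ →L[ℂ] H₀)) : StarCAR K →⋆ₐ[ℂ]
    (lp (fun _ : X => H₀) 2 →L[ℂ] lp (fun _ : X => H₀) 2) :=
  directSumRep (fun y : X => π₀.comp (StarAlgHomClass.toStarAlgHom (β (Multiplicative.ofAdd (-y)))))
    (fun a => by
      obtain ⟨M, hM⟩ := StarCAR.exists_norm_le a
      exact ⟨M, fun _ => hM H₀ _⟩)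

theorem carRep_apply (π₀ : StarCAR K →⋆ₐ[ℂ] (H₀ →L[ℂ] H₀)) (c : StarCAR K)
    (ψ : lp (fun _ : X => H₀) 2) (y : X) :
    carRep β π₀ c ψ y = π₀ (β (Multiplicative.ofAdd (-y)) c) (ψ y) :=
  rfl

theorem star_weylOp (hσ : ∀ x, σ x x = 0) (x : X) :
    star (weylOp (H₀ := H₀) σ x) = weylOp σ (-x) := by
  refine star_weightedPerm _ _ _ _ _ _ (by ext y; simp) fun y => ?_
  rw [Complex.star_def, ← Complex.exp_conj]
  have h2 : starRingEnd ℂ 2 = 2 := map_ofNat _ 2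
  simp [hσ, h2, neg_div]

/-- The twist by `β_{-y}` at the site `y` is chosen for this: `β_{-y} β_x = β_{-(y - x)}`, so
translation by `x` implements `β_x`. -/
theorem weylOp_mul_carRep (π₀ : StarCAR K →⋆ₐ[ℂ] (H₀ →L[ℂ] H₀)) (x : X) (c : StarCAR K) :
    weylOp σ x * carRep β π₀ c = carRep β π₀ (β (Multiplicative.ofAdd x) c) * weylOp σ x := by
  ext ψ y
  change weylOp σ x (carRep β π₀ c ψ) y =
    carRep β π₀ (β (Multiplicative.ofAdd x) c) (weylOp σ x ψ) y
  have h : β (Multiplicative.ofAdd (-y)) (β (Multiplicative.ofAdd x) c) =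
      β (Multiplicative.ofAdd (-(y - x))) c := by
    rw [neg_sub, sub_eq_neg_add, ofAdd_add, map_mul]
    rfl
  rw [weylOp_apply, carRep_apply, carRep_apply, weylOp_apply, map_smul, h]

/-- A *-representation of `𝓑` on `ℓ²(X, H₀)` extending the one of `*CAR`. -/
theorem exists_rep (hσ : ∀ x y, σ x y = -σ y x) (π₀ : StarCAR K →⋆ₐ[ℂ] (H₀ →L[ℂ] H₀)) :
    ∃ π : FieldStarAlg σ β →⋆ₐ[ℂ] (lp (fun _ : X => H₀) 2 →L[ℂ] lp (fun _ : X => H₀) 2),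
      (∀ c, π (ofCAR σ β c) = carRep β π₀ c) ∧ ∀ x, π (weyl σ β x) = weylOp σ x := by
  set F : FreeStarAlg (K ⊕ X) →⋆ₐ[ℂ] (lp (fun _ : X => H₀) 2 →L[ℂ] lp (fun _ : X => H₀) 2) :=
    FreeStarAlg.lift (Sum.elim (fun f => carRep β π₀ (StarCAR.annihilator f)) (weylOp σ))
  have hcar : ∀ p, F (carPoly K X p) = carRep β π₀ (PresentedStarAlg.mk (CARRel K) p) := by
    have : F.comp (carPoly K X) = (carRep β π₀).comp (PresentedStarAlg.mk (CARRel K)) :=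
      FreeStarAlg.hom_ext fun f => by
        simp only [StarAlgHom.comp_apply, carPoly, FreeStarAlg.lift_gen, F, Sum.elim_inl]
        rfl
    exact fun p => DFunLike.congr_fun this p
  have hweyl : ∀ x, F (weylSymb K x) = weylOp σ x := fun x => FreeStarAlg.lift_gen _ _
  have hF : ∀ p q, FieldRel σ β p q → F p = F q := by
    intro p q h
    cases h with
    | car h => rw [hcar, hcar, PresentedStarAlg.mk_rel h]
    | weyl_star x =>
      rw [map_star, hweyl, hweyl, star_weylOp σ fun x => self_eq_neg.1 (hσ x x)]
    | weyl_zero => rw [hweyl, weylOp_zero, map_one]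
    | weyl_mul x y => rw [map_mul, map_smul, hweyl, hweyl, hweyl, weylOp_mul σ hσ]
    | twist x p q h => rw [map_mul, map_mul, hweyl, hcar, hcar, h, weylOp_mul_carRep]
  refine ⟨PresentedStarAlg.lift F hF, fun c => ?_, fun x => ?_⟩
  · obtain ⟨p, rfl⟩ := PresentedStarAlg.mk_surjective _ c
    rw [ofCAR_mk, PresentedStarAlg.lift_mk, hcar]
  · rw [weyl, PresentedStarAlg.lift_mk, hweyl]

/-- `W(x)` carries a vector at the site `0` to the site `x`, with phase `1` since `σ x x = 0`. Hence
the component at `y` sees only `C y`, and `π₀` and `β_{-y}` are injective. -/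
theorem eq_zero_of_rep_normalForm_eq_zero (hσ : ∀ x, σ x x = 0)
    {π₀ : StarCAR K →⋆ₐ[ℂ] (H₀ →L[ℂ] H₀)} (hπ₀ : Function.Injective π₀)
    {π : FieldStarAlg σ β →⋆ₐ[ℂ] (lp (fun _ : X => H₀) 2 →L[ℂ] lp (fun _ : X => H₀) 2)}
    (hcar : ∀ c, π (ofCAR σ β c) = carRep β π₀ c) (hweyl : ∀ x, π (weyl σ β x) = weylOp σ x)
    {C : X →₀ StarCAR K} (h : π (normalForm σ β C) = 0) : C = 0 := by
  classical
  have key : ∀ (D : X →₀ StarCAR K) (v : H₀) (y : X), π (normalForm σ β D) (lp.single 2 0 v) y =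
      π₀ (β (Multiplicative.ofAdd (-y)) (D y)) v := by
    intro D v y
    induction D using Finsupp.induction_linear with
    | zero => simp
    | add D D' hD hD' => simp [hD, hD']
    | single x c =>
      rw [normalForm_single, map_mul, hcar, hweyl]
      change carRep β π₀ c (weylOp σ x (lp.single 2 0 v)) y = _
      rw [carRep_apply, weylOp_apply, lp.single_apply]
      by_cases hxy : x = y
      · subst hxy
        simp [hσ]
      · have : y - x ≠ 0 := fun h => hxy (sub_eq_zero.1 h).symm
        simp [Pi.single_eq_of_ne this, Finsupp.single_eq_of_ne' hxy]
  ext y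
  have h1 : π₀ (β (Multiplicative.ofAdd (-y)) (C y)) = 0 := by
    ext v
    rw [← key, h]
    rfl
  rw [map_eq_zero_iff π₀ hπ₀] at h1
  simpa using h1

end Representation

end FieldStarAlg

end

theorem proposition2p1 {K : Type u} [NormedAddCommGroup K] [InnerProductSpace ℂ K]
    [CompleteSpace K] {X : Type v} [AddCommGroup X]
    (σ : X →+ X →+ ℝ) (hσ : ∀ x y, σ x y = -σ y x)
    (β : Multiplicative X →* (StarCAR K ≃⋆ₐ[ℂ] StarCAR K)) :
    (∀ (n : ℕ) (x : Fin n → X) (C : Fin n → StarCAR K), 0 < n → Function.Injective x →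
      (∀ i, C i ≠ 0) →
      ∑ i, FieldStarAlg.ofCAR σ β (C i) * FieldStarAlg.weyl σ β (x i) ≠ 0) ∧
    (∀ b : FieldStarAlg σ β, ∃! C : X →₀ StarCAR K,
      b = C.sum (fun x c => FieldStarAlg.ofCAR σ β c * FieldStarAlg.weyl σ β x)) ∧
    (∃ (H : Type (max u v)) (_ : NormedAddCommGroup H) (_ : InnerProductSpace ℂ H)
      (_ : CompleteSpace H) (π : FieldStarAlg σ β →⋆ₐ[ℂ] (H →L[ℂ] H)),
      Function.Injective π) := by
  obtain ⟨H₀, _, _, _, π₀, hπ₀⟩ := StarCAR.exists_faithful_rep (K := K)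
  obtain ⟨π, hcar, hweyl⟩ := FieldStarAlg.exists_rep σ β hσ π₀
  -- Stated through `π`, this yields injectivity of both `normalForm` and `π`.
  have hzero : ∀ C, π (FieldStarAlg.normalForm σ β C) = 0 → C = 0 := fun C =>
    FieldStarAlg.eq_zero_of_rep_normalForm_eq_zero σ β (fun x => self_eq_neg.1 (hσ x x)) hπ₀
      hcar hweyl
  have hinj : Function.Injective (FieldStarAlg.normalForm σ β) :=
    (injective_iff_map_eq_zero _).2 fun C hC => hzero C (by rw [hC, map_zero])
  refine ⟨fun n x C hn hx hC h => ?_, fun b => ?_, ?_⟩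
  · classical
    have h1 : ∑ i, Finsupp.single (x i) (C i) = 0 := hinj (by
      rw [map_sum, map_zero, ← h]
      exact Finset.sum_congr rfl fun i _ => FieldStarAlg.normalForm_single σ β _ _)
    have h2 := DFunLike.congr_fun h1 (x ⟨0, hn⟩)
    rw [Finsupp.finsetSum_apply, Finset.sum_eq_single ⟨0, hn⟩, Finsupp.single_eq_same] at h2
    · exact hC _ h2
    · exact fun j _ hj => Finsupp.single_eq_of_ne' fun h => hj (hx h)
    · simp
  · obtain ⟨C, rfl⟩ := FieldStarAlg.normalForm_surjective σ β b
    exact ⟨C, rfl, fun D hD => (hinj hD).symm⟩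
  · refine ⟨_, _, _, inferInstance, π, (injective_iff_map_eq_zero _).2 fun b hb => ?_⟩
    obtain ⟨C, rfl⟩ := FieldStarAlg.normalForm_surjective σ β b
    rw [hzero C hb, map_zero]
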